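/- The power graph $\Gamma_G$ of a group $G$ has vertex set $G$, and two distinct elements are adjacent if and only if one is a power of the other. A finite simple graph $\Gamma$ embeds into $\Gamma_G$ if there is an injective map $V(\Gamma)\to G$ sending edges to edges. The power index $\Theta(\Gamma)$ is the least order of a finite group $G$ such that $\Gamma$ embeds into $\Gamma_G$. A finite group $G$ is $\Gamma$-optimal if $\Gamma$ embeds into $\Gamma_G$ and $|G|=\Theta(\Gamma)$, and $\Gamma$ is power-critical if $|V(\Gamma)|=\Theta(\Gamma)$. Let $K_{s,t}$ be the complete bipartite graph with parts of sizes $s$ and $t$, let $\mathbb Z_n$ be the cyclic group of order $n$, and for $k\ge 3$ let $$Q_{2^k}=\langle x,y : x^{2^{k-2}}=y^2,\ x^{2^{k-1}}=1,\ y^{-1}xy=x^{-1}\rangle$$ be the generalized quaternion group of order $2^k$. (i) For every integer $k\ge 3$, a group $G$ is $K_{2,2^k-2}$-optimal if and only if $G\cong\mathbb Z_{2^k}$ or $G\cong Q_{2^k}$. (ii) Let $2\le s\le t$ be integers such that $K_{s,t}$ is power-critical and $(s,t)\ne(2,2^k-2)$ for every integer $k\ge 3$. Then a group $G$ is $K_{s,t}$-optimal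 if and only if $G\cong\mathbb Z_{s+t}$. -/

import Mathlib

/-- The (undirected) power graph of a group `G`: the vertices are the elements of `G`, and two
distinct elements are adjacent when one of them is a power of the other. -/
def powerGraph (G : Type*) [Group G] : SimpleGraph G where
  Adj x y := x ≠ y ∧ ((∃ n : ℤ, x ^ n = y) ∨ ∃ n : ℤ, y ^ n = x)
  symm := ⟨fun _ _ h => ⟨h.1.symm, h.2.symm⟩⟩
  loopless := ⟨fun _ h => h.1 rfl⟩

/-- The power index of a finite graph `Γ`: the least order of a finite group `G` such that `Γ`
embeds into the power graph of `G`. An embedding is an injective map of the vertices which sends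
edges to edges (`Γ ⊑ Γ'`, that is, `SimpleGraph.IsContained`). The set below is never empty, since
the power graph of a cyclic group of prime power order is complete; every finite group has an
isomorphic copy in `Type`, so no order is missed. -/
noncomputable def powerIndex {V : Type*} [Finite V] (Γ : SimpleGraph V) : ℕ :=
  sInf {n : ℕ | ∃ (G : Type) (_ : Group G), Finite G ∧ Nat.card G = n ∧
    Γ.IsContained (powerGraph G)}

/-- A group `G` is `Γ`-optimal if it is finite, `Γ` embeds into its power graph and its order is
the power index of `Γ`. -/
def IsOptimal {V : Type*} [Finite V] (Γ : SimpleGraph V) (G : Type*) [Group G] : Prop :=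
  Finite G ∧ Γ.IsContained (powerGraph G) ∧ Nat.card G = powerIndex Γ

/-- A finite graph is power-critical if its order equals its power index. -/
def IsPowerCritical {V : Type*} [Finite V] (Γ : SimpleGraph V) : Prop :=
  Nat.card V = powerIndex Γ

/-- The complete bipartite graph `K_{s,t}`. -/
abbrev completeBipartite (s t : ℕ) : SimpleGraph (Fin s ⊕ Fin t) :=
  completeBipartiteGraph (Fin s) (Fin t)

/-! If `|G| = s + t`, an embedding of `K_{s,t}` is a bijection, so it splits `G` into `A` and `Aᶜ`
with any two elements from different sides comparable (`exists_isPowerSplit`). Suppose `G` is not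
cyclic. Generators of distinct maximal cyclic subgroups are incomparable, so all such generators lie
on one side; call the other side `A`. Each element of `A` then lies in every maximal cyclic
subgroup, so `A` is central. If `A` has a nontrivial element, two primes dividing `|G|` would put
all elements of prime power order into one cyclic subgroup, so `G` is a `p`-group, and it has a
single subgroup of order `p`. Such a noncyclic group is generalized quaternion. Its centre has order
2, so a side with at least two elements has exactly two. Conversely, in a 2-group with a single
involution `z`, the set `{1, z}` and its complement form such a split. -/

open Subgroup

/-! ### Arithmetic of `u ^ p ≡ 1` modulo a prime power -/

/-- Since `u ≢ 1`, the relation `(u - 1) * j ≡ 0` forces `p ∣ j`. As `w` is a unit modulo `p ^ n`,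
take `i = -(j / p) * w⁻¹`. -/
theorem exists_dvd_mul_add_of_eq_prime_mul {p : ℕ} (hp : p.Prime) {n : ℕ} {u j S w : ℤ}
    (hS : S = p * w) (hw : ¬ (p : ℤ) ∣ w) (h2 : ¬ (p : ℤ) ^ n ∣ u - 1)
    (h3 : (p : ℤ) ^ n ∣ (u - 1) * j) : ∃ i : ℤ, (p : ℤ) ^ n ∣ i * S + j := by
  have hp' : Prime (p : ℤ) := Nat.prime_iff_prime_int.mp hp
  have hj : (p : ℤ) ∣ j := by
    by_contra hj
    exact h2 (IsCoprime.dvd_of_dvd_mul_right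
      (IsCoprime.pow_left ((Prime.coprime_iff_not_dvd hp').2 hj)) h3)
  obtain ⟨j, rfl⟩ := hj
  obtain ⟨α, β, h⟩ : IsCoprime w ((p : ℤ) ^ n) :=
    (IsCoprime.pow_left ((Prime.coprime_iff_not_dvd hp').2 hw)).symm
  refine ⟨-j * α, p * j * β, ?_⟩
  rw [hS]
  linear_combination (-(p : ℤ) * j) * h

/-- For `x` acting on `⟨a⟩` as `a ↦ a ^ u` with `x ^ p = a ^ j`, a solution `i` makes `(a ^ i * x) ^
p = 1`. Fermat gives `u ≡ 1` mod `p`. For odd `p` the sum is `p` modulo `p ^ 2`, so the previous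
lemma applies. -/
theorem exists_dvd_mul_geom_sum_add {p : ℕ} (hp : p.Prime) {n : ℕ} {u j : ℤ}
    (h1 : (p : ℤ) ^ n ∣ u ^ p - 1) (h2 : ¬ (p : ℤ) ^ n ∣ u - 1)
    (h3 : (p : ℤ) ^ n ∣ (u - 1) * j) :
    (∃ i : ℤ, (p : ℤ) ^ n ∣ i * (∑ k ∈ Finset.range p, u ^ k) + j) ∨
      (p = 2 ∧ (2 : ℤ) ^ n ∣ u + 1) := by
  have hp' : Prime (p : ℤ) := Nat.prime_iff_prime_int.mp hp
  have hn : n ≠ 0 := by rintro rfl; simp at h2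
  have hu : (p : ℤ) ∣ u - 1 := by
    have h4 : (p : ℤ) ∣ u ^ p - 1 := (dvd_pow_self _ hn).trans h1
    have : Fact p.Prime := ⟨hp⟩
    rw [← ZMod.intCast_zmod_eq_zero_iff_dvd] at h4 ⊢
    push_cast at h4 ⊢
    rwa [ZMod.pow_card] at h4
  rcases hp.eq_two_or_odd' with rfl | hodd
  · obtain ⟨v, hv⟩ := hu
    obtain rfl : u = 2 * v + 1 := by push_cast at hv; linarith
    rcases Int.even_or_odd' v with ⟨w, rfl | rfl⟩
    · left
      refine exists_dvd_mul_add_of_eq_prime_mul hp (w := 2 * w + 1) ?_ ?_ h2 h3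
      · simp [Finset.sum_range_succ]; ring
      · push_cast; omega
    -- Here `u ≡ 3` mod 4, so `u - 1` is twice an odd number and `2 ^ (n - 1)` divides both `j` and
    -- `u + 1`. The parity of `(u + 1) / 2 ^ (n - 1)` decides the case.
    · obtain ⟨m, rfl⟩ := Nat.exists_eq_succ_of_ne_zero hn
      push_cast at h1 h3 ⊢
      rw [Nat.succ_eq_add_one, pow_succ'] at *
      have hodd : IsCoprime ((2 : ℤ) ^ m) (2 * w + 1) :=
        IsCoprime.pow_left ⟨-w, 1, by ring⟩
      have hj : (2 : ℤ) ^ m ∣ (2 * w + 1) * j :=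
        Int.dvd_of_mul_dvd_mul_left (a := 2) two_ne_zero (h3.trans (dvd_of_eq (by ring)))
      have hu : (2 : ℤ) ^ m ∣ (2 * w + 1) * (2 * (2 * w + 1) + 1 + 1) :=
        Int.dvd_of_mul_dvd_mul_left (a := 2) two_ne_zero (h1.trans (dvd_of_eq (by ring)))
      replace hj := hodd.dvd_of_dvd_mul_left hj
      replace hu := hodd.dvd_of_dvd_mul_left hu
      obtain ⟨c, hc⟩ := hu
      obtain ⟨d, rfl⟩ := hj
      rcases Int.even_or_odd' c with ⟨e, rfl | rfl⟩
      · right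
        exact ⟨trivial, e, by rw [hc]; ring⟩
      · left
        refine ⟨d, d * (e + 1), ?_⟩
        simp only [Finset.sum_range_succ, Finset.range_zero, Finset.sum_empty, pow_zero, pow_one]
        linear_combination d * hc
  · left
    obtain ⟨v, hv⟩ := hu
    obtain rfl : u = 1 + p * v := by linarith
    obtain ⟨c, hc⟩ := odd_sq_dvd_geom_sum₂_sub (1 : ℤ) v hodd
    simp only [one_pow, mul_one] at hc
    refine exists_dvd_mul_add_of_eq_prime_mul hp (w := 1 + p * c) (by linear_combination hc) ?_ h2 h3
    intro h
    exact hp'.not_dvd_one ((dvd_add_left (dvd_mul_right _ _)).1 h)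

/-! ### Elements of a group -/

section
variable {G : Type*} [Group G]

theorem conj_zpow_of_conj {a x : G} {u : ℤ} (h : x * a * x⁻¹ = a ^ u) (i : ℤ) :
    x * a ^ i * x⁻¹ = a ^ (u * i) := by
  rw [← conj_zpow, h, zpow_mul]

theorem conj_pow_zpow_of_conj {a x : G} {u : ℤ} (h : x * a * x⁻¹ = a ^ u) (m : ℕ) :
    x ^ m * a * (x ^ m)⁻¹ = a ^ (u ^ m) := by
  induction m with
  | zero => simp
  | succ m ih =>
    rw [pow_succ' u, ← conj_zpow_of_conj h, ← ih, pow_succ']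
    group

theorem zpow_mul_pow_of_conj {a x : G} {u : ℤ} (h : x * a * x⁻¹ = a ^ u) (i : ℤ) (m : ℕ) :
    (a ^ i * x) ^ m = a ^ (i * ∑ k ∈ Finset.range m, u ^ k) * x ^ m := by
  induction m with
  | zero => simp
  | succ m ih =>
    have h1 := conj_zpow_of_conj h (i * ∑ k ∈ Finset.range m, u ^ k)
    rw [pow_succ', ih, Finset.sum_range_succ', pow_succ' x]
    have h2 : i * (∑ k ∈ Finset.range m, u ^ (k + 1) + u ^ 0) =
        i + u * (i * ∑ k ∈ Finset.range m, u ^ k) := by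
      simp only [pow_succ, ← Finset.sum_mul]; ring
    rw [h2, zpow_add, ← h1]
    group

theorem mem_zpowers_of_pow_eq_one {m x : G} {p : ℕ} (hp : p ≠ 0) (hm : p ∣ orderOf m)
    (hx : x ∈ zpowers m) (hxp : x ^ p = 1) :
    x ∈ zpowers (m ^ (orderOf m / p)) := by
  obtain ⟨i, rfl⟩ := mem_zpowers_iff.1 hx
  obtain ⟨d, hd⟩ := hm
  rw [← zpow_natCast, ← zpow_mul, ← orderOf_dvd_iff_zpow_eq_one, hd] at hxp
  have h1 : (d : ℤ) ∣ i := by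
    refine Int.dvd_of_mul_dvd_mul_left (a := (p : ℤ)) (by exact_mod_cast hp) ?_
    push_cast at hxp
    rwa [mul_comm i] at hxp
  obtain ⟨e, rfl⟩ := h1
  rw [hd, Nat.mul_div_cancel_left _ (Nat.pos_of_ne_zero hp)]
  exact mem_zpowers_iff.2 ⟨e, by rw [← zpow_natCast, ← zpow_mul]⟩

theorem zpowers_eq_of_mem_of_orderOf_eq [Finite G] {x y : G} (h : x ∈ zpowers y)
    (ho : orderOf x = orderOf y) : zpowers x = zpowers y := by
  refine Subgroup.eq_of_le_of_card_ge (zpowers_le.2 h) ?_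
  rw [Nat.card_zpowers, Nat.card_zpowers, ho]

theorem mem_zpowers_zpow_of_not_dvd {a : G} {p n : ℕ} (hp : p.Prime) (ha : orderOf a = p ^ n)
    {i : ℤ} (hi : ¬ (p : ℤ) ∣ i) : a ∈ zpowers (a ^ i) := by
  obtain ⟨α, β, h⟩ : IsCoprime i ((p : ℤ) ^ n) :=
    (IsCoprime.pow_left ((Prime.coprime_iff_not_dvd (Nat.prime_iff_prime_int.mp hp)).2 hi)).symm
  refine mem_zpowers_iff.2 ⟨α, ?_⟩
  rw [← zpow_mul]
  conv_rhs => rw [← zpow_one a]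
  rw [zpow_eq_zpow_iff_modEq, ha, Int.modEq_iff_dvd]
  exact ⟨β, by push_cast; linear_combination -h⟩

end

/-! ### Finite `p`-groups with a single subgroup of order `p` -/

section
variable {G : Type*} [Group G] [Finite G] {p : ℕ} [hp : Fact p.Prime]

theorem IsPGroup.exists_orderOf_eq_mem (hG : IsPGroup p G) {N : Subgroup G} (hN : N ≠ ⊥) :
    ∃ x ∈ N, orderOf x = p := by
  have : Nontrivial N := (Subgroup.nontrivial_iff_ne_bot N).2 hN
  obtain ⟨n, hn, hc⟩ := (hG.to_subgroup N).nontrivial_iff_card.1 this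
  obtain ⟨x, hx⟩ := exists_prime_orderOf_dvd_card' (G := N) p (hc ▸ dvd_pow_self p hn.ne')
  exact ⟨x, x.2, by rwa [Subgroup.orderOf_coe]⟩

/-- Conjugation fixes `1 ∈ N` and `p ∣ |N|`, so it fixes another point of `N`, which is central. -/
theorem IsPGroup.exists_orderOf_eq_mem_inf_center (hG : IsPGroup p G) {N : Subgroup G} [N.Normal]
    (hN : N ≠ ⊥) : ∃ x ∈ N, x ∈ center G ∧ orderOf x = p := by
  have hne : N ⊓ center G ≠ ⊥ := by
    have : Nontrivial N := (Subgroup.nontrivial_iff_ne_bot N).2 hN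
    obtain ⟨n, hn, hc⟩ := (hG.to_subgroup N).nontrivial_iff_card.1 this
    have h1 : (1 : N) ∈ MulAction.fixedPoints (ConjAct G) N := fun g => smul_one g
    obtain ⟨b, hb, hb1⟩ :=
      (hG.of_equiv ConjAct.toConjAct).exists_fixed_point_of_prime_dvd_card_of_fixed_point N
        (hc ▸ dvd_pow_self p hn.ne') h1
    intro h
    refine hb1 (Subtype.ext ?_)
    have : (b : G) ∈ N ⊓ center G := by
      refine ⟨b.2, Subgroup.mem_center_iff.2 fun g => ?_⟩
      have h2 := congrArg (fun y : N => (y : G)) (hb (ConjAct.toConjAct g))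
      simp only [ConjAct.Subgroup.val_conj_smul, ConjAct.toConjAct_smul] at h2
      exact mul_inv_eq_iff_eq_mul.1 h2
    rw [h] at this
    exact (Subgroup.mem_bot.1 this).symm
  obtain ⟨x, hx, ho⟩ := hG.exists_orderOf_eq_mem hne
  exact ⟨x, hx.1, hx.2, ho⟩

theorem IsPGroup.exists_mem_not_mem_central_mod (hG : IsPGroup p G) {A C : Subgroup G} [A.Normal]
    [C.Normal] (h : ¬ C ≤ A) :
    ∃ x ∈ C, x ∉ A ∧ x ^ p ∈ A ∧ ∀ g : G, g * x * g⁻¹ * x⁻¹ ∈ A := by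
  have : (C.map (QuotientGroup.mk' A)).Normal :=
    Subgroup.Normal.map inferInstance _ (QuotientGroup.mk'_surjective A)
  have hne : C.map (QuotientGroup.mk' A) ≠ ⊥ := by
    rwa [Ne, Subgroup.map_eq_bot_iff, QuotientGroup.ker_mk']
  obtain ⟨z, ⟨x, hxC, rfl⟩, hzc, hzp⟩ := (hG.to_quotient A).exists_orderOf_eq_mem_inf_center hne
  refine ⟨x, hxC, fun hx => ?_, ?_, fun g => ?_⟩
  · rw [QuotientGroup.mk'_apply, (QuotientGroup.eq_one_iff x).2 hx, orderOf_one] at hzp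
    exact hp.out.one_lt.ne hzp
  · rw [← QuotientGroup.eq_one_iff, QuotientGroup.mk_pow, ← hzp]
    exact pow_orderOf_eq_one _
  · rw [← QuotientGroup.eq_one_iff]
    have := Subgroup.mem_center_iff.1 hzc (g : G ⧸ A)
    rw [QuotientGroup.mk'_apply] at this
    simp only [QuotientGroup.mk_mul, QuotientGroup.mk_inv, this]
    group

theorem IsPGroup.mem_zpowers_of_pow_eq_one (hG : IsPGroup p G) {z : G}
    (hz : ∀ x : G, x ^ p = 1 → x ∈ zpowers z) (hzp : z ^ p = 1) {a x : G} (ha : a ≠ 1)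
    (hx : x ^ p = 1) : x ∈ zpowers a := by
  have hpa : p ∣ orderOf a := hG.dvd_orderOf ha
  have hb : orderOf (a ^ (orderOf a / p)) = p := orderOf_pow_orderOf_div (orderOf_pos a).ne' hpa
  have h2 := hz (a ^ (orderOf a / p))
    (by rw [← pow_mul, Nat.div_mul_cancel hpa, pow_orderOf_eq_one])
  have h4 : zpowers (a ^ (orderOf a / p)) = zpowers z := by
    refine Subgroup.eq_of_le_of_card_ge (zpowers_le.2 h2) ?_
    rw [Nat.card_zpowers, Nat.card_zpowers, hb]
    exact Nat.le_of_dvd hp.out.pos (orderOf_dvd_of_pow_eq_one hzp)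
  exact zpowers_le.2 (pow_mem (mem_zpowers a) _) (h4 ▸ hz x hx)

/-- In a `p`-group with only one subgroup of order `p` there is a self-centralizing normal
cyclic subgroup. -/
theorem IsPGroup.exists_normal_zpowers_centralizer_le (hG : IsPGroup p G) {z : G}
    (hz : ∀ x : G, x ^ p = 1 → x ∈ zpowers z) (hzp : z ^ p = 1) :
    ∃ a : G, (zpowers a).Normal ∧ centralizer (zpowers a : Set G) ≤ zpowers a := by
  obtain ⟨a, ha, hmax⟩ := (Set.toFinite {a : G | (zpowers a).Normal}).exists_maximalFor
    (fun a => zpowers a) _ ⟨1, by simp only [Set.mem_ofPred_eq, zpowers_one_eq_bot]; infer_instance⟩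
  refine ⟨a, ha, ?_⟩
  by_contra hC
  have : (zpowers a).Normal := ha
  obtain ⟨x, hxC, hxA, hxp, hx⟩ := hG.exists_mem_not_mem_central_mod hC
  refine hxA ?_
  -- As `x` is central modulo `⟨a⟩`, this makes `⟨x⟩` normal, and maximality of `⟨a⟩` puts `x` in
  -- it.
  suffices a ∈ zpowers x by
    refine hmax (j := x) ⟨fun y hy g => ?_⟩ (zpowers_le.2 this) (mem_zpowers x)
    have hgx : g * x * g⁻¹ ∈ zpowers x := by
      have := mul_mem (zpowers_le.2 this (hx g)) (mem_zpowers x)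
      simpa using this
    obtain ⟨i, rfl⟩ := mem_zpowers_iff.1 hy
    rw [← conj_zpow]
    exact zpow_mem hgx i
  obtain ⟨i, hi⟩ := mem_zpowers_iff.1 hxp
  -- If `i = p * j`, then `x * a ^ (-j)` is killed by `p`, hence lies in `⟨a⟩` unless `a = 1`.
  -- Otherwise `a ^ i = x ^ p` generates `⟨a⟩`.
  by_cases hd : (p : ℤ) ∣ i
  · obtain ⟨j, rfl⟩ := hd
    have hcomm : Commute x (a ^ (-j)) :=
      (mem_centralizer_iff.1 hxC _ (zpow_mem (mem_zpowers a) _)).symm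
    have h1 : (x * a ^ (-j)) ^ p = 1 := by
      rw [hcomm.mul_pow, ← hi, ← zpow_natCast, ← zpow_mul, ← zpow_add]
      simp [mul_comm]
    by_cases ha1 : a = 1
    · rw [ha1]; exact one_mem _
    exfalso
    refine hxA ?_
    have := mul_mem (hG.mem_zpowers_of_pow_eq_one hz hzp ha1 h1) (zpow_mem (mem_zpowers a) j)
    simpa using this
  · obtain ⟨n, hn⟩ := (IsPGroup.iff_orderOf.1 hG) a
    have := mem_zpowers_zpow_of_not_dvd hp.out hn hd
    rw [hi] at this
    exact zpowers_le.2 (pow_mem (mem_zpowers x) p) this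
end

theorem nonempty_mulEquiv_quaternionGroup {G : Type*} [Group G] {a x : G} {m : ℕ}
    (ha : orderOf a = 2 * m) (hx : x ∉ zpowers a) (hc : x * a * x⁻¹ = a⁻¹) (hx2 : x ^ 2 = a ^ m)
    (hG : ∀ y, y ∈ zpowers a ∨ x * y ∈ zpowers a) : Nonempty (G ≃* QuaternionGroup m) := by
  have hcast : ∀ i j : ℤ, (i : ZMod (2 * m)) = j ↔ a ^ i = a ^ j := fun i j => by
    rw [zpow_eq_zpow_iff_modEq, ha, ZMod.intCast_eq_intCast_iff]
  let E : ZMod (2 * m) → G := fun i => a ^ (ZMod.cast i : ℤ)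
  have hE : ∀ i : ℤ, E i = a ^ i := fun i => (hcast _ _).1 (ZMod.intCast_zmod_cast _)
  have hmove : ∀ i : ℤ, a ^ i * x = x * a ^ (-i) := fun i => by
    have : x * a ^ (-i) * x⁻¹ = a ^ i := by rw [← conj_zpow, hc]; simp
    rw [← this]; group
  let f : QuaternionGroup m → G := fun q => match q with
    | .a i => E i
    | .xa i => x * E i
  have fa : ∀ i : ℤ, f (.a i) = a ^ i := hE
  have fxa : ∀ i : ℤ, f (.xa i) = x * a ^ i := fun i => congrArg (x * ·) (hE i)
  have hmul : ∀ q r, f (q * r) = f q * f r := by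
    rintro (i | i) (j | j) <;> obtain ⟨i, rfl⟩ := ZMod.intCast_surjective i <;>
      obtain ⟨j, rfl⟩ := ZMod.intCast_surjective j
    · rw [QuaternionGroup.a_mul_a, ← Int.cast_add, fa, fa, fa, zpow_add]
    · rw [QuaternionGroup.a_mul_xa, ← Int.cast_sub, fa, fxa, fxa, ← mul_assoc, hmove, mul_assoc,
        ← zpow_add]
      congr 2; ring
    · rw [QuaternionGroup.xa_mul_a, ← Int.cast_add, fa, fxa, fxa, zpow_add, mul_assoc]
    · rw [QuaternionGroup.xa_mul_xa, ← Int.cast_natCast m, ← Int.cast_add, ← Int.cast_sub, fa, fxa,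
        fxa, mul_assoc, ← mul_assoc _ x, hmove, mul_assoc, ← mul_assoc x, ← pow_two, hx2,
        ← zpow_natCast, ← zpow_add, ← zpow_add]
      congr 1; ring
  have hxa : ∀ i j : ℤ, x * a ^ i ≠ a ^ j := fun i j h => hx <| by
    rw [eq_mul_inv_of_mul_eq h]
    exact mul_mem (zpow_mem (mem_zpowers a) _) (inv_mem (zpow_mem (mem_zpowers a) _))
  refine ⟨(MulEquiv.ofBijective (MonoidHom.mk' f hmul) ⟨?_, fun y => ?_⟩).symm⟩
  · rintro (i | i) (j | j) h <;> obtain ⟨i, rfl⟩ := ZMod.intCast_surjective i <;>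
      obtain ⟨j, rfl⟩ := ZMod.intCast_surjective j <;>
      simp only [MonoidHom.mk'_apply, fa, fxa, mul_right_inj] at h
    · rw [(hcast i j).2 h]
    · exact absurd h.symm (hxa _ _)
    · exact absurd h (hxa _ _)
    · rw [(hcast i j).2 h]
  · rcases hG y with h | h <;> obtain ⟨i, hi⟩ := mem_zpowers_iff.1 h
    · exact ⟨.a i, by rw [MonoidHom.mk'_apply, fa, hi]⟩
    -- From `x * y = a ^ i` and `x ^ 2 = a ^ m` follows `y = x * a ^ (i - m)`.
    · refine ⟨.xa ((i - m : ℤ) : ZMod (2 * m)), ?_⟩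
      rw [MonoidHom.mk'_apply, fxa, sub_eq_add_neg, add_comm, zpow_add, hi, zpow_neg, zpow_natCast,
        ← hx2]
      group

theorem mem_centralizer_zpowers_of_conj_eq {G : Type*} [Group G] {a y : G}
    (h : y * a * y⁻¹ = a) : y ∈ centralizer (zpowers a : Set G) := by
  rw [zpowers_eq_closure, centralizer_closure, mem_centralizer_singleton_iff]
  exact mul_inv_eq_iff_eq_mul.1 h

section
variable {G : Type*} [Group G] [Finite G] {p : ℕ} [hp : Fact p.Prime]

/-- No `a ^ i * x` is killed by `p`, since it would lie in `⟨a⟩` and so would `x`. The arithmetic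
lemma then leaves only `p = 2` and `u ≡ -1`. -/
theorem IsPGroup.conj_eq_inv_of_pow_mem (hG : IsPGroup p G) {z : G}
    (hz : ∀ x : G, x ^ p = 1 → x ∈ zpowers z) (hzp : z ^ p = 1) {a x : G} {n : ℕ}
    (ha : (zpowers a).Normal) (hC : centralizer (zpowers a : Set G) ≤ zpowers a)
    (hn : orderOf a = p ^ n) (hx : x ∉ zpowers a) (hxp : x ^ p ∈ zpowers a) :
    p = 2 ∧ 2 ≤ n ∧ x * a * x⁻¹ = a⁻¹ ∧ x ^ 2 = a ^ (2 ^ (n - 1)) := by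
  have hcent : ∀ y, y * a * y⁻¹ = a → y ∈ zpowers a := fun y hy =>
    hC (mem_centralizer_zpowers_of_conj_eq hy)
  have hdvd : ∀ k : ℤ, (p : ℤ) ^ n ∣ k ↔ a ^ k = 1 := fun k => by
    rw [← orderOf_dvd_iff_zpow_eq_one, hn]; push_cast; rfl
  have ha1 : a ≠ 1 := by
    rintro rfl
    exact hx (hcent x (by simp))
  obtain ⟨u, hu⟩ := mem_zpowers_iff.1 (ha.conj_mem a (mem_zpowers a) x)
  obtain ⟨j, hj⟩ := mem_zpowers_iff.1 hxp
  have h1 : (p : ℤ) ^ n ∣ u ^ p - 1 := by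
    rw [hdvd, zpow_sub, ← conj_pow_zpow_of_conj hu.symm, ← hj]; group
  have h2 : ¬ (p : ℤ) ^ n ∣ u - 1 := by
    rw [hdvd, zpow_sub, zpow_one, mul_inv_eq_one, hu]
    exact fun h => hx (hcent x h)
  have h3 : (p : ℤ) ^ n ∣ (u - 1) * j := by
    rw [hdvd, sub_mul, one_mul, zpow_sub, ← conj_zpow_of_conj hu.symm, hj, mul_inv_eq_one,
      mul_inv_eq_iff_eq_mul]
    exact (Commute.self_pow x p).eq
  have hno : ∀ i : ℤ, ¬ (p : ℤ) ^ n ∣ i * (∑ k ∈ Finset.range p, u ^ k) + j := fun i hi => by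
    have h4 : (a ^ i * x) ^ p = 1 := by
      rw [zpow_mul_pow_of_conj hu.symm, ← hj, ← zpow_add, ← hdvd]
      exact hi
    have := mul_mem (zpow_mem (mem_zpowers a) (-i)) (hG.mem_zpowers_of_pow_eq_one hz hzp ha1 h4)
    rw [← mul_assoc, ← zpow_add, neg_add_cancel, zpow_zero, one_mul] at this
    exact hx this
  obtain ⟨i, hi⟩ | ⟨rfl, hu1⟩ := exists_dvd_mul_geom_sum_add hp.out h1 h2 h3
  · exact absurd hi (hno i)
  push_cast at *
  have hj0 : ¬ (2 : ℤ) ^ n ∣ j := by simpa using hno 0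
  have hn2 : 2 ≤ n := by
    by_contra hlt
    refine h2 ?_
    have : (2 : ℤ) ^ n ∣ 2 := by simpa using pow_dvd_pow (2 : ℤ) (show n ≤ 1 by omega)
    exact (dvd_sub hu1 this).trans (dvd_of_eq (by ring))
  refine ⟨trivial, hn2, ?_, ?_⟩
  · rw [← hu, ← zpow_neg_one, ← mul_inv_eq_one, ← zpow_neg, ← zpow_add, ← hdvd]
    simpa using hu1
  -- From `u ≡ -1` and `(u - 1) * j ≡ 0` comes `2 * j ≡ 0`, while `j ≢ 0`; hence `j ≡ 2 ^ (n - 1)`.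
  · obtain ⟨m, rfl⟩ := Nat.exists_eq_succ_of_ne_zero (show n ≠ 0 by omega)
    rw [Nat.succ_eq_add_one, pow_succ'] at *
    have h5 : (2 : ℤ) ^ m ∣ j := by
      have h6 : 2 * (2 : ℤ) ^ m ∣ 2 * j := by
        have := dvd_sub (hu1.mul_right j) h3
        exact this.trans (dvd_of_eq (by ring))
      exact Int.dvd_of_mul_dvd_mul_left (a := 2) two_ne_zero h6
    obtain ⟨d, rfl⟩ := h5
    rw [← hj, Nat.add_sub_cancel, ← zpow_natCast, ← mul_inv_eq_one, ← zpow_neg, ← zpow_add, ← hdvd]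
    rcases Int.even_or_odd' d with ⟨e, rfl | rfl⟩
    · exact absurd ⟨e, by ring⟩ hj0
    · exact ⟨e, by push_cast; ring⟩

/-- A noncyclic finite `p`-group with only one subgroup of order `p` is generalized quaternion. -/
theorem IsPGroup.nonempty_mulEquiv_quaternionGroup (hG : IsPGroup p G) {z : G}
    (hz : ∀ x : G, x ^ p = 1 → x ∈ zpowers z) (hzp : z ^ p = 1) (hnc : ¬ IsCyclic G) :
    ∃ n : ℕ, 1 ≤ n ∧ Nonempty (G ≃* QuaternionGroup (2 ^ n)) := by
  obtain ⟨a, ha, hC⟩ := hG.exists_normal_zpowers_centralizer_le hz hzp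
  have htop : ¬ (⊤ : Subgroup G) ≤ zpowers a := fun h =>
    hnc ⟨a, fun x => h (mem_top x)⟩
  obtain ⟨n, hn⟩ := (IsPGroup.iff_orderOf.1 hG) a
  obtain ⟨x, -, hx, hxp, -⟩ := hG.exists_mem_not_mem_central_mod htop
  obtain ⟨rfl, hn2, hxa, hx2⟩ := hG.conj_eq_inv_of_pow_mem hz hzp ha hC hn hx hxp
  obtain ⟨m, rfl⟩ := Nat.exists_eq_add_of_le' hn2
  refine ⟨m + 1, by omega, ?_⟩
  refine nonempty_mulEquiv_quaternionGroup (a := a) (x := x) (by rw [hn]; ring) hx hxa hx2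
    fun y => or_iff_not_imp_left.2 fun hy => ?_
  -- The last `y ^ 2 ^ r` outside `⟨a⟩` inverts `a`. If `r > 0` it is a square, which makes `-1` a
  -- square modulo 4. So `r = 0`, and `x * y` centralizes `a`.
  have hya : y * a * y⁻¹ = a⁻¹ := by
    obtain ⟨k, hk⟩ := (isPGroup_iff_pow_pow_eq_one.1 hG) y
    have hex : ∃ k, y ^ 2 ^ k ∈ zpowers a := ⟨k, hk ▸ one_mem _⟩
    classical
    have hk0 : Nat.find hex ≠ 0 := fun h => hy (by simpa [h] using Nat.find_spec hex)
    obtain ⟨r, hr⟩ := Nat.exists_eq_succ_of_ne_zero hk0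
    have hr1 : y ^ 2 ^ r ∉ zpowers a := Nat.find_min hex (by omega)
    have hr2 : (y ^ 2 ^ r) ^ 2 ∈ zpowers a := by
      rw [← pow_mul, ← pow_succ, ← Nat.succ_eq_add_one, ← hr]; exact Nat.find_spec hex
    have hinv := (hG.conj_eq_inv_of_pow_mem hz hzp ha hC hn hr1 hr2).2.2.1
    rcases r with _ | r
    · simpa using hinv
    · exfalso
      obtain ⟨u, hu⟩ := mem_zpowers_iff.1 (ha.conj_mem a (mem_zpowers a) (y ^ 2 ^ r))
      have h2 := conj_pow_zpow_of_conj hu.symm 2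
      rw [← pow_mul, ← pow_succ, hinv, ← zpow_neg_one, zpow_eq_zpow_iff_modEq, hn] at h2
      have h4 : (-1 : ℤ) ≡ u ^ 2 [ZMOD 4] := h2.of_dvd ⟨2 ^ m, by push_cast; ring⟩
      rcases Int.even_or_odd' u with ⟨v, rfl | rfl⟩
      · have : (2 * v) ^ 2 = 4 * v ^ 2 := by ring
        rw [this, Int.ModEq] at h4; omega
      · have : (2 * v + 1) ^ 2 = 4 * (v ^ 2 + v) + 1 := by ring
        rw [this, Int.ModEq] at h4; omega
  refine hC (mem_centralizer_zpowers_of_conj_eq ?_)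
  have : x * (y * a * y⁻¹) * x⁻¹ = a := by rw [hya, conj_inv.symm, hxa, inv_inv]
  exact Eq.trans (by group) this
end

/-! ### Maximal cyclic subgroups and bipartitions of the power graph -/

/-- `m` generates a maximal cyclic subgroup. -/
def GeneratesMaximalCyclic {G : Type*} [Group G] (m : G) : Prop :=
  ∀ y : G, m ∈ zpowers y → y ∈ zpowers m

/-- Every element of `A` is comparable, for the relation of being a power of, with every element
outside `A`. -/
def IsPowerSplit {G : Type*} [Group G] (A : Set G) : Prop :=
  ∀ a ∈ A, ∀ b ∉ A, b ∈ zpowers a ∨ a ∈ zpowers b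

section
variable {G : Type*} [Group G]

theorem IsPowerSplit.compl {A : Set G} (h : IsPowerSplit A) : IsPowerSplit Aᶜ :=
  fun a ha b hb => (h b (not_not.1 hb) a ha).symm

theorem IsPowerSplit.mem_iff_of_not_mem {A : Set G} (h : IsPowerSplit A) {x y : G}
    (hxy : x ∉ zpowers y) (hyx : y ∉ zpowers x) : x ∈ A ↔ y ∈ A := by
  by_contra hne
  rcases not_iff.1 hne with hne
  by_cases hx : x ∈ A
  · exact (h x hx y fun hy => hne.2 hy hx).elim hyx hxy
  · exact (h y (hne.1 hx) x hx).elim hxy hyx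

theorem GeneratesMaximalCyclic.zpowers_eq {m m' : G} (hm : GeneratesMaximalCyclic m)
    (h : m ∈ zpowers m') : zpowers m = zpowers m' :=
  le_antisymm (zpowers_le.2 h) (zpowers_le.2 (hm m' h))

theorem IsPowerSplit.mem_zpowers {A : Set G} (h : IsPowerSplit A)
    (hmax : ∀ m, GeneratesMaximalCyclic m → m ∉ A) {a m : G} (ha : a ∈ A)
    (hm : GeneratesMaximalCyclic m) : a ∈ zpowers m :=
  (h a ha m (hmax m hm)).elim (hm a) id

theorem eq_of_mem_zpowers_of_orderOf_eq_pow {x y : G} {r s i j : ℕ} (hr : r.Prime) (hs : s.Prime)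
    (hx : orderOf x = r ^ i) (hx1 : x ≠ 1) (hy : orderOf y = s ^ j) (h : x ∈ zpowers y) :
    r = s := by
  have h1 : r ^ i ∣ s ^ j := hx ▸ hy ▸ orderOf_dvd_of_mem_zpowers h
  have hi : i ≠ 0 := by
    rintro rfl
    exact hx1 (orderOf_eq_one_iff.1 (by simpa using hx))
  exact (Nat.prime_dvd_prime_iff_eq hr hs).1 (hr.dvd_of_dvd_pow ((dvd_pow_self r hi).trans h1))

variable [Finite G]

theorem exists_generatesMaximalCyclic (g : G) :
    ∃ m, GeneratesMaximalCyclic m ∧ g ∈ zpowers m := by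
  obtain ⟨m, hm, hmax⟩ := (Set.toFinite {y : G | g ∈ zpowers y}).exists_maximalFor
    (fun y => zpowers y) _ ⟨g, mem_zpowers g⟩
  exact ⟨m, fun y hy => hmax (j := y) (zpowers_le.2 hy hm) (zpowers_le.2 hy) (mem_zpowers y), hm⟩

theorem IsPowerSplit.mem_iff_of_generatesMaximalCyclic {A : Set G} (h : IsPowerSplit A)
    (hnc : ¬ IsCyclic G) {m m' : G} (hm : GeneratesMaximalCyclic m)
    (hm' : GeneratesMaximalCyclic m') : m ∈ A ↔ m' ∈ A := by
  have key : ∀ {x y : G}, GeneratesMaximalCyclic x → GeneratesMaximalCyclic y →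
      zpowers x ≠ zpowers y → (x ∈ A ↔ y ∈ A) := fun hx hy hne =>
    h.mem_iff_of_not_mem (fun hxy => hne (hx.zpowers_eq hxy)) fun hyx => hne (hy.zpowers_eq hyx).symm
  by_cases heq : zpowers m = zpowers m'
  -- Two generators of the same subgroup are compared through a generator of another one.
  · obtain ⟨g, hg⟩ : ∃ g, g ∉ zpowers m := by
      by_contra hall
      exact hnc ⟨m, not_exists_not.1 hall⟩
    obtain ⟨l, hl, hgl⟩ := exists_generatesMaximalCyclic g
    have hne : zpowers m ≠ zpowers l := fun h' => hg (h' ▸ hgl)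
    exact (key hm hl hne).trans (key hm' hl (heq ▸ hne)).symm
  · exact key hm hm' heq

theorem eq_top_of_forall_orderOf_eq_pow_mem {H : Subgroup G}
    (hH : ∀ (r k : ℕ) (x : G), r.Prime → orderOf x = r ^ k → x ≠ 1 → x ∈ H) : H = ⊤ := by
  refine Subgroup.eq_top_of_card_eq H (Nat.dvd_antisymm H.card_subgroup_dvd_card ?_)
  rw [Nat.dvd_iff_prime_pow_dvd_dvd]
  intro p k hp hk
  have := Fact.mk hp
  obtain ⟨K, hK⟩ := Sylow.exists_subgroup_card_pow_prime p hk
  rw [← hK]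
  refine Subgroup.card_dvd_of_le fun x hx => ?_
  by_cases h1 : x = 1
  · exact h1 ▸ one_mem H
  obtain ⟨l, -, hl⟩ := (Nat.dvd_prime_pow hp).1 (hK ▸ K.orderOf_dvd_natCard hx)
  exact hH p l x hp hl h1

variable {A : Set G}

theorem IsPowerSplit.eq_of_prime_dvd_card (h : IsPowerSplit A)
    (hmax : ∀ m, GeneratesMaximalCyclic m → m ∉ A) (hnc : ¬ IsCyclic G) {a : G} (ha : a ∈ A)
    (ha1 : a ≠ 1) {p q : ℕ} (hp : p.Prime) (hq : q.Prime) (hpG : p ∣ Nat.card G)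
    (hqG : q ∣ Nat.card G) : p = q := by
  by_contra hpq
  have hdiff : ∀ {x y : G} {r s i j : ℕ}, r.Prime → s.Prime → orderOf x = r ^ i → x ≠ 1 →
      orderOf y = s ^ j → y ≠ 1 → r ≠ s → (x ∈ A ↔ y ∈ A) := fun hr hs hx hx1 hy hy1 hrs =>
    h.mem_iff_of_not_mem (fun hxy => hrs (eq_of_mem_zpowers_of_orderOf_eq_pow hr hs hx hx1 hy hxy))
      fun hyx => hrs (eq_of_mem_zpowers_of_orderOf_eq_pow hs hr hy hy1 hx hyx).symm
  have hother : ∀ r : ℕ, ∃ t : ℕ, t.Prime ∧ r ≠ t ∧ t ∣ Nat.card G := fun r => by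
    by_cases hrp : r = p
    · exact ⟨q, hq, hrp ▸ hpq, hqG⟩
    · exact ⟨p, hp, hrp, hpG⟩
  -- Elements belonging to the same prime are compared through an element of another prime order.
  have hsame : ∀ {x y : G} {r s i j : ℕ}, r.Prime → s.Prime → orderOf x = r ^ i → x ≠ 1 →
      orderOf y = s ^ j → y ≠ 1 → (x ∈ A ↔ y ∈ A) := fun {x y r s i j} hr hs hx hx1 hy hy1 => by
    by_cases hrs : r = s
    · obtain ⟨t, ht, hrt, htG⟩ := hother r
      have := Fact.mk ht
      obtain ⟨w, hw⟩ := exists_prime_orderOf_dvd_card' t htG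
      have hw1 : w ≠ 1 := by
        rintro rfl
        exact ht.one_lt.ne (by simpa using hw)
      rw [← pow_one t] at hw
      exact (hdiff hr ht hx hx1 hw hw1 hrt).trans (hdiff hs ht hy hy1 hw hw1 (hrs ▸ hrt)).symm
    · exact hdiff hr hs hx hx1 hy hy1 hrs
  obtain ⟨m, hm, -⟩ := exists_generatesMaximalCyclic (1 : G)
  have htop : zpowers m = ⊤ := eq_top_of_forall_orderOf_eq_pow_mem fun r k x hr hx hx1 => by
    by_cases hxA : x ∈ A
    · exact h.mem_zpowers hmax hxA hm
    · rcases h a ha x hxA with hxa | hax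
      · exact zpowers_le.2 (h.mem_zpowers hmax ha hm) hxa
      · obtain ⟨l, -, hl⟩ := (Nat.dvd_prime_pow hr).1 (hx ▸ orderOf_dvd_of_mem_zpowers hax)
        exact absurd ((hsame hr hr hl ha1 hx hx1).1 ha) hxA
  exact hnc (isCyclic_iff_exists_zpowers_eq_top.2 ⟨m, htop⟩)

theorem IsPowerSplit.exists_mulEquiv_quaternionGroup (h : IsPowerSplit A)
    (hmax : ∀ m, GeneratesMaximalCyclic m → m ∉ A) (hnc : ¬ IsCyclic G) {a : G} (ha : a ∈ A)
    (ha1 : a ≠ 1) : ∃ n : ℕ, 1 ≤ n ∧ Nonempty (G ≃* QuaternionGroup (2 ^ n)) := by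
  have hcard : Nat.card G ≠ 1 := fun hc =>
    ha1 ((Nat.card_eq_one_iff_unique.1 hc).1.elim a 1)
  obtain ⟨p, hp, hpG⟩ := Nat.exists_prime_and_dvd hcard
  have hpf := Fact.mk hp
  have hG : IsPGroup p G := IsPGroup.of_card (Nat.eq_prime_pow_of_unique_prime_dvd
    Nat.card_pos.ne' fun hq hqG => h.eq_of_prime_dvd_card hmax hnc ha ha1 hq hp hqG hpG)
  obtain ⟨m, hm, -⟩ := exists_generatesMaximalCyclic (1 : G)
  -- For `x ∉ A`, either `x ∈ ⟨a⟩`, or `a ∈ ⟨x⟩` and both have order `p`, so `⟨a⟩ = ⟨x⟩`. In each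
  -- case `x ∈ ⟨a⟩ ⊆ ⟨m⟩`.
  have hmem : ∀ x : G, x ^ p = 1 → x ∈ zpowers m := fun x hx => by
    by_cases hxA : x ∈ A
    · exact h.mem_zpowers hmax hxA hm
    have ham := h.mem_zpowers hmax ha hm
    rcases h a ha x hxA with hxa | hax
    · exact zpowers_le.2 ham hxa
    · have hx1 : x ≠ 1 := by
        rintro rfl
        exact ha1 (by simpa using hax)
      have hxo : orderOf x = p := orderOf_eq_prime hx hx1
      have hao : orderOf a = p := ((Nat.dvd_prime hp).1
        (hxo ▸ orderOf_dvd_of_mem_zpowers hax)).resolve_left (mt orderOf_eq_one_iff.1 ha1)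
      have := zpowers_eq_of_mem_of_orderOf_eq hax (hao.trans hxo.symm)
      exact zpowers_le.2 ham (this ▸ Subgroup.mem_zpowers x)
  have hpm : p ∣ orderOf m := hG.dvd_orderOf fun h1 =>
    ha1 (by simpa [h1] using h.mem_zpowers hmax ha hm)
  refine hG.nonempty_mulEquiv_quaternionGroup (z := m ^ (orderOf m / p))
    (fun x hx => mem_zpowers_of_pow_eq_one hp.ne_zero hpm (hmem x hx) hx) ?_ hnc
  rw [← pow_mul, Nat.div_mul_cancel hpm, pow_orderOf_eq_one]

theorem IsPowerSplit.subset_center (h : IsPowerSplit A)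
    (hmax : ∀ m, GeneratesMaximalCyclic m → m ∉ A) : A ⊆ center G := by
  intro a ha
  refine mem_center_iff.2 fun g => ?_
  obtain ⟨m, hm, hg⟩ := exists_generatesMaximalCyclic g
  obtain ⟨i, rfl⟩ := mem_zpowers_iff.1 hg
  obtain ⟨j, rfl⟩ := mem_zpowers_iff.1 (h.mem_zpowers hmax ha hm)
  exact zpow_mul_comm m i j
end

/-! ### Centre and involution of the generalized quaternion groups -/

theorem ZMod.eq_zero_or_eq_of_add_self {m : ℕ} {i : ZMod (2 * m)} (h : i + i = 0) :
    i = 0 ∨ i = m := by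
  obtain ⟨i, rfl⟩ := ZMod.intCast_surjective i
  rw [← Int.cast_add, ZMod.intCast_zmod_eq_zero_iff_dvd, ← two_mul] at h
  push_cast at h
  obtain ⟨e, rfl⟩ := Int.dvd_of_mul_dvd_mul_left (a := 2) two_ne_zero h
  have h0 : (2 * (m : ZMod (2 * m))) = 0 := by exact_mod_cast ZMod.natCast_self (2 * m)
  rcases Int.even_or_odd' e with ⟨d, rfl | rfl⟩
  · left; push_cast; linear_combination (d : ZMod (2 * m)) * h0
  · right; push_cast; linear_combination (d : ZMod (2 * m)) * h0

/-- For `m = 1` the group is cyclic of order 4, and the claim fails. -/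
theorem QuaternionGroup.eq_of_mem_center {m : ℕ} (hm : 2 ≤ m) {q : QuaternionGroup m}
    (hq : q ∈ center (QuaternionGroup m)) : q = 1 ∨ q = .a m := by
  rcases q with i | i
  · have h := mem_center_iff.1 hq (.xa 0)
    rw [xa_mul_a, a_mul_xa, xa.injEq] at h
    rcases ZMod.eq_zero_or_eq_of_add_self (i := i) (by linear_combination h) with rfl | rfl
    · exact Or.inl rfl
    · exact Or.inr rfl
  · have h := mem_center_iff.1 hq (.a 1)
    rw [xa_mul_a, a_mul_xa, xa.injEq] at h
    have h2 : ((2 : ℕ) : ZMod (2 * m)) = 0 := by push_cast; linear_combination -h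
    rw [ZMod.natCast_eq_zero_iff] at h2
    have := Nat.le_of_dvd two_pos h2
    omega

theorem QuaternionGroup.eq_of_sq_eq_one {m : ℕ} (hm : m ≠ 0) {q : QuaternionGroup m}
    (hq : q ^ 2 = 1) : q = 1 ∨ q = .a m := by
  rcases q with i | i
  · rw [sq, a_mul_a, one_def, a.injEq] at hq
    rcases ZMod.eq_zero_or_eq_of_add_self hq with rfl | rfl
    · exact Or.inl rfl
    · exact Or.inr rfl
  · rw [xa_sq, one_def, a.injEq, ZMod.natCast_eq_zero_iff] at hq
    have := Nat.le_of_dvd (Nat.pos_of_ne_zero hm) hq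
    omega

section
variable {G : Type*} [Group G] [Finite G] {A : Set G}

theorem IsPowerSplit.exists_mulEquiv_quaternionGroup_and_ncard (h : IsPowerSplit A)
    (hmax : ∀ m, GeneratesMaximalCyclic m → m ∉ A) (hnc : ¬ IsCyclic G) (hA : 2 ≤ A.ncard) :
    ∃ n : ℕ, 1 ≤ n ∧ Nonempty (G ≃* QuaternionGroup (2 ^ n)) ∧ A.ncard = 2 := by
  obtain ⟨a, ha, ha1⟩ := Set.exists_ne_of_one_lt_ncard (show 1 < A.ncard from hA) 1
  obtain ⟨n, hn, ⟨e⟩⟩ := h.exists_mulEquiv_quaternionGroup hmax hnc ha ha1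
  refine ⟨n, hn, ⟨e⟩, le_antisymm ?_ hA⟩
  have hsub : A ⊆ {1, e.symm (.a (2 ^ n : ℕ))} := fun x hx => by
    have hc : e x ∈ center _ := mem_center_iff.2 fun g => by
      obtain ⟨g, rfl⟩ := e.surjective g
      rw [← map_mul, ← map_mul, mem_center_iff.1 (h.subset_center hmax hx) g]
    rcases QuaternionGroup.eq_of_mem_center (Nat.le_self_pow (by omega) 2) hc with h1 | h1
    · exact Or.inl (e.map_eq_one_iff.1 h1)
    · exact Or.inr (e.eq_symm_apply.2 h1)
  exact (Set.ncard_le_ncard hsub (Set.toFinite _)).trans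
    ((Set.ncard_insert_le _ _).trans (by rw [Set.ncard_singleton]))

theorem IsPowerSplit.exists_mulEquiv_quaternionGroup_of_not_isCyclic (h : IsPowerSplit A)
    (hnc : ¬ IsCyclic G) (hA : 2 ≤ A.ncard) (hA' : 2 ≤ Aᶜ.ncard) :
    ∃ n : ℕ, 1 ≤ n ∧ Nonempty (G ≃* QuaternionGroup (2 ^ n)) ∧ (A.ncard = 2 ∨ Aᶜ.ncard = 2) := by
  by_cases hmax : ∀ m, GeneratesMaximalCyclic m → m ∉ A
  · obtain ⟨n, hn, e, h2⟩ := h.exists_mulEquiv_quaternionGroup_and_ncard hmax hnc hA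
    exact ⟨n, hn, e, Or.inl h2⟩
  · push Not at hmax
    obtain ⟨m, hm, hmA⟩ := hmax
    obtain ⟨n, hn, e, h2⟩ := h.compl.exists_mulEquiv_quaternionGroup_and_ncard
      (fun m' hm' hA => hA ((h.mem_iff_of_generatesMaximalCyclic hnc hm hm').1 hmA)) hnc hA'
    exact ⟨n, hn, e, Or.inr h2⟩
end

/-! ### Complete bipartite subgraphs of power graphs -/

theorem powerGraph_isContained_of_mulEquiv {G H : Type*} [Group G] [Group H] (e : G ≃* H) :
    (powerGraph G).IsContained (powerGraph H) := by
  refine ⟨⟨⟨e, fun {x y} hxy => ⟨e.injective.ne hxy.1, ?_⟩⟩, e.injective⟩⟩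
  exact hxy.2.imp (fun ⟨n, hn⟩ => ⟨n, by rw [← map_zpow, hn]⟩)
    fun ⟨n, hn⟩ => ⟨n, by rw [← map_zpow, hn]⟩

theorem completeBipartite_isContained {G : Type*} [Group G] [Finite G] {A : Set G} {s t : ℕ}
    (h : IsPowerSplit A) (hs : A.ncard = s) (ht : Aᶜ.ncard = t) :
    (completeBipartite s t).IsContained (powerGraph G) := by
  let e₁ : Fin s ≃ A := (Finite.equivFinOfCardEq hs).symm
  let e₂ : Fin t ≃ (Aᶜ : Set G) := (Finite.equivFinOfCardEq ht).symm
  have hne : ∀ i j, (e₁ i : G) ≠ e₂ j := fun i j hij => (e₂ j).2 (hij ▸ (e₁ i).2)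
  refine ⟨⟨⟨Sum.elim (fun i => e₁ i) (fun j => e₂ j), ?_⟩, ?_⟩⟩
  · rintro (i | i) (j | j) hij
    · simp at hij
    · exact ⟨hne i j, h _ (e₁ i).2 _ (e₂ j).2⟩
    · exact ⟨(hne j i).symm, (h _ (e₁ j).2 _ (e₂ i).2).symm⟩
    · simp at hij
  · exact (Subtype.val_injective.comp e₁.injective).sumElim
      (Subtype.val_injective.comp e₂.injective) hne

theorem exists_isPowerSplit {G : Type*} [Group G] [Finite G] {s t : ℕ}
    (h : (completeBipartite s t).IsContained (powerGraph G)) (hc : Nat.card G = s + t) :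
    ∃ A : Set G, IsPowerSplit A ∧ A.ncard = s ∧ Aᶜ.ncard = t := by
  obtain ⟨f⟩ := h
  have hinj : Function.Injective f := f.injective
  have hbij : Function.Bijective f :=
    (Nat.bijective_iff_injective_and_card f).2 ⟨hinj, by simp [hc]⟩
  have hs : (Set.range fun i : Fin s => f (Sum.inl i)).ncard = s := by
    rw [← Nat.card_coe_set_eq]
    exact (Nat.card_range_of_injective (hinj.comp Sum.inl_injective)).trans (Nat.card_fin s)
  refine ⟨Set.range fun i => f (Sum.inl i), ?_, hs, ?_⟩
  · rintro _ ⟨i, rfl⟩ b hb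
    obtain ⟨j | j, rfl⟩ := hbij.2 b
    · exact absurd ⟨j, rfl⟩ hb
    · exact (f.toHom.map_adj (show (completeBipartite s t).Adj (.inl i) (.inr j) by simp)).2
  · rw [Set.ncard_compl, hs, hc]
    omega

theorem add_le_card_of_isContained {G : Type*} [Group G] [Finite G] {s t : ℕ}
    (h : (completeBipartite s t).IsContained (powerGraph G)) : s + t ≤ Nat.card G := by
  obtain ⟨f⟩ := h
  simpa using Nat.card_le_card_of_injective f f.injective

theorem completeBipartite_two_isContained {G : Type*} [Group G] [Finite G] {k : ℕ} (hk : k ≠ 0)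
    (hG : Nat.card G = 2 ^ k) {z : G} (hz : ∀ x : G, x ^ 2 = 1 → x = 1 ∨ x = z) :
    (completeBipartite 2 (2 ^ k - 2)).IsContained (powerGraph G) := by
  -- Cauchy's theorem shows that `z` really is an involution, which the hypothesis on `z` leaves
  -- open.
  obtain ⟨w, hw⟩ := exists_prime_orderOf_dvd_card' (G := G) 2 (hG ▸ dvd_pow_self 2 hk)
  have hne : ∀ {x : G}, orderOf x = 2 → x ≠ 1 := by
    rintro x hx rfl
    simp at hx
  have huniq : ∀ {x : G}, orderOf x = 2 → x = z := fun hx =>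
    (hz _ (hx ▸ pow_orderOf_eq_one _)).resolve_left (hne hx)
  have hz2 : orderOf z = 2 := huniq hw ▸ hw
  have hcard : ({1, z} : Set G).ncard = 2 := Set.ncard_pair (hne hz2).symm
  refine completeBipartite_isContained (A := {1, z}) ?_ hcard (by rw [Set.ncard_compl, hcard, hG])
  rintro a (rfl | rfl) b hb
  · exact Or.inr (one_mem _)
  · right
    have hb1 : b ≠ 1 := fun h => hb (Or.inl h)
    have hdvd : 2 ∣ orderOf b := (IsPGroup.of_card hG).dvd_orderOf hb1
    rw [← huniq (orderOf_pow_orderOf_div (orderOf_pos b).ne' hdvd)]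
    exact pow_mem (mem_zpowers b) _

theorem completeBipartite_two_isContained_zmod {k : ℕ} (hk : k ≠ 0) :
    (completeBipartite 2 (2 ^ k - 2)).IsContained (powerGraph (Multiplicative (ZMod (2 ^ k)))) := by
  obtain ⟨m, rfl⟩ := Nat.exists_eq_succ_of_ne_zero hk
  rw [Nat.succ_eq_add_one, pow_succ']
  have : NeZero (2 * 2 ^ m) := ⟨by positivity⟩
  have := completeBipartite_two_isContained (G := Multiplicative (ZMod (2 * 2 ^ m))) hk
    (by simp [pow_succ']) (z := Multiplicative.ofAdd ((2 ^ m : ℕ) : ZMod (2 * 2 ^ m)))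
    fun x hx => ZMod.eq_zero_or_eq_of_add_self (i := x.toAdd) (by rw [sq] at hx; exact hx)
  rwa [pow_succ'] at this

theorem completeBipartite_two_isContained_quaternionGroup {k : ℕ} (hk : 2 ≤ k) :
    (completeBipartite 2 (2 ^ k - 2)).IsContained
      (powerGraph (QuaternionGroup (2 ^ (k - 2)))) := by
  refine completeBipartite_two_isContained (by omega) ?_
    fun x hx => QuaternionGroup.eq_of_sq_eq_one (by positivity) hx
  rw [Nat.card_eq_fintype_card, QuaternionGroup.card]
  obtain ⟨m, rfl⟩ := Nat.exists_eq_add_of_le' hk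
  rw [Nat.add_sub_cancel]; ring

theorem powerIndex_completeBipartite_two {k : ℕ} (hk : k ≠ 0) :
    powerIndex (completeBipartite 2 (2 ^ k - 2)) = 2 ^ k := by
  have : NeZero (2 ^ k) := ⟨by positivity⟩
  have h2 : 2 ≤ 2 ^ k := Nat.le_self_pow hk 2
  have hmem : 2 ^ k ∈ {n : ℕ | ∃ (G : Type) (_ : Group G), Finite G ∧ Nat.card G = n ∧
      (completeBipartite 2 (2 ^ k - 2)).IsContained (powerGraph G)} :=
    ⟨Multiplicative (ZMod (2 ^ k)), inferInstance, inferInstance, by simp,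
      completeBipartite_two_isContained_zmod hk⟩
  refine le_antisymm (Nat.sInf_le hmem) (le_csInf ⟨_, hmem⟩ ?_)
  rintro n ⟨G, _, _, rfl, hG⟩
  have := add_le_card_of_isContained hG
  omega

theorem isCyclic_or_mulEquiv_quaternionGroup {G : Type*} [Group G] [Finite G] {s t : ℕ}
    (hs : 2 ≤ s) (ht : 2 ≤ t) (h : (completeBipartite s t).IsContained (powerGraph G))
    (hc : Nat.card G = s + t) :
    IsCyclic G ∨ ∃ n : ℕ, 1 ≤ n ∧ Nonempty (G ≃* QuaternionGroup (2 ^ n)) ∧ s + t = 2 ^ (n + 2) ∧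
      (s = 2 ∨ t = 2) := by
  refine or_iff_not_imp_left.2 fun hnc => ?_
  obtain ⟨A, hA, rfl, rfl⟩ := exists_isPowerSplit h hc
  obtain ⟨n, hn, ⟨e⟩, h2⟩ := hA.exists_mulEquiv_quaternionGroup_of_not_isCyclic hnc hs ht
  refine ⟨n, hn, ⟨e⟩, ?_, h2⟩
  rw [← hc, Nat.card_congr e.toEquiv, Nat.card_eq_fintype_card, QuaternionGroup.card]
  ring

theorem isCyclic_of_ne_two {G : Type*} [Group G] [Finite G] {s t : ℕ} (hs : 2 ≤ s) (hst : s ≤ t)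
    (hne : ∀ k : ℕ, 3 ≤ k → (s, t) ≠ (2, 2 ^ k - 2))
    (h : (completeBipartite s t).IsContained (powerGraph G)) (hc : Nat.card G = s + t) :
    IsCyclic G := by
  obtain hcyc | ⟨n, hn, -, hsum, h2⟩ :=
    isCyclic_or_mulEquiv_quaternionGroup hs (hs.trans hst) h hc
  · exact hcyc
  -- If `t = 2`, then `s = 2` as well, because `2 ≤ s ≤ t`.
  · have h2s : s = 2 := by omega
    exact absurd (Prod.ext h2s (by simp only; omega)) (hne (n + 2) (by omega))

theorem nonempty_mulEquiv_zmod {G : Type*} [Group G] [IsCyclic G] {n : ℕ} (h : Nat.card G = n) :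
    Nonempty (G ≃* Multiplicative (ZMod n)) :=
  ⟨(mulEquivOfCyclicCardEq (by simp [h, Nat.card_congr Multiplicative.toAdd]))⟩

theorem corollary3p7 :
    (∀ k : ℕ, 3 ≤ k → ∀ (G : Type*) [Group G],
      IsOptimal (completeBipartite 2 (2 ^ k - 2)) G ↔
        Nonempty (G ≃* Multiplicative (ZMod (2 ^ k))) ∨
          Nonempty (G ≃* QuaternionGroup (2 ^ (k - 2)))) ∧
    (∀ s t : ℕ, 2 ≤ s → s ≤ t → IsPowerCritical (completeBipartite s t) →
      (∀ k : ℕ, 3 ≤ k → (s, t) ≠ (2, 2 ^ k - 2)) →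
        ∀ (G : Type*) [Group G],
          IsOptimal (completeBipartite s t) G ↔
            Nonempty (G ≃* Multiplicative (ZMod (s + t)))) := by
  refine ⟨fun k hk G _ => ?_, fun s t hs hst hcrit hne G _ => ?_⟩
  · have h8 : 2 ^ 3 ≤ 2 ^ k := Nat.pow_le_pow_right two_pos hk
    have hidx := powerIndex_completeBipartite_two (k := k) (by omega)
    have : NeZero (2 ^ k) := ⟨by positivity⟩
    constructor
    · rintro ⟨_, hcont, hcard⟩
      rw [hidx] at hcard
      obtain hcyc | ⟨n, hn, he, hsum, -⟩ := isCyclic_or_mulEquiv_quaternionGroup le_rfl (by omega)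
        hcont (by omega)
      · exact Or.inl (nonempty_mulEquiv_zmod hcard)
      · right
        have hkn : k = n + 2 := Nat.pow_right_injective le_rfl (by simp only; omega)
        rwa [hkn, Nat.add_sub_cancel]
    · rintro (⟨⟨e⟩⟩ | ⟨⟨e⟩⟩)
      · exact ⟨Finite.of_equiv _ e.symm.toEquiv,
          (completeBipartite_two_isContained_zmod (by omega)).trans
            (powerGraph_isContained_of_mulEquiv e.symm),
          by rw [hidx, Nat.card_congr e.toEquiv]; simp⟩
      · refine ⟨Finite.of_equiv _ e.symm.toEquiv,
          (completeBipartite_two_isContained_quaternionGroup (by omega)).trans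
            (powerGraph_isContained_of_mulEquiv e.symm), ?_⟩
        rw [hidx, Nat.card_congr e.toEquiv, Nat.card_eq_fintype_card, QuaternionGroup.card]
        obtain ⟨m, rfl⟩ := Nat.exists_eq_add_of_le' (show 2 ≤ k by omega)
        rw [Nat.add_sub_cancel]; ring
  · have hidx : powerIndex (completeBipartite s t) = s + t := by
      rw [← hcrit]; simp
    constructor
    · rintro ⟨_, hcont, hcard⟩
      have := isCyclic_of_ne_two hs hst hne hcont (hcard.trans hidx)
      exact nonempty_mulEquiv_zmod (hcard.trans hidx)
    · rintro ⟨e⟩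
      -- The infimum of the empty set is `0`, so a positive index is attained by some `H`. This `H`
      -- is cyclic of order `s + t`, hence isomorphic to `G`, and its embedding transfers.
      obtain ⟨H, _, _, hcard, hcont⟩ := Nat.sInf_mem (Nat.nonempty_of_pos_sInf
        (show 0 < powerIndex (completeBipartite s t) by omega))
      replace hcard : Nat.card H = s + t := hcard.trans hidx
      have := isCyclic_of_ne_two hs hst hne hcont hcard
      obtain ⟨e'⟩ := nonempty_mulEquiv_zmod hcard
      have e'' := e'.trans e.symm
      exact ⟨Finite.of_equiv _ e''.toEquiv,
        hcont.trans (powerGraph_isContained_of_mulEquiv e''),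
        by rw [hidx, ← hcard, Nat.card_congr e''.toEquiv]⟩
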